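/- All topological spaces are assumed non-empty. **Notions.** A space is *irresolvable* if it is not the union of two disjoint dense subsets, and *hereditarily irresolvable* (HI) if each of its non-empty subspaces is irresolvable. *Modal formulas* are built from propositional letters $p_0,p_1,\dots$ by $\top,\wedge,\neg,\Box$; under a valuation assigning subsets of a space $X$ to the letters, $\Box\varphi$ is true at a point $w$ iff $\varphi$ is true throughout some open neighbourhood of $w$; and $\varphi$ is valid in $X$ if it is true at every point under every valuation. A class $\mathsf K$ of spaces is *modally definable* if there is a set $\Gamma$ of modal formulas that defines it, i.e. for every space $X$: $X\in\mathsf K$ iff all formulas of $\Gamma$ are valid in $X$. The two-sorted first-order language $\mathcal L^2$ has point variables $x,y,\dots$ (ranging over the points of a space) and open variables $U,V,\dots$ (ranging over its open sets); its formulas are built from $\top$, $x=y$, $U=V$, $x\,\varepsilon\,U$ by $\neg$, $\wedge$, $\exists x$, $\exists U$ (the other connectives and quantifiers being the usual abbreviations). A formula is *positive* (*negative*) in $U$ if all free occurrences of $U$ are under an even (odd) number of negation signs. $\mathcal L_t$ is the smallest set of formulas that contains the atomic ones, is closed under $\neg$, $\wedge$ and $\exists x$, and contains $\forall U(x\,\varepsilon\,U\to\alpha)$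 whenever it contains $\alpha$ and $\alpha$ is positive in $U$, and $\exists U(x\,\varepsilon\,U\wedge\alpha)$ whenever it contains $\alpha$ and $\alpha$ is negative in $U$. A class $\mathsf K$ of spaces is *$\mathcal L_t$-definable* if there is a set $\Gamma$ of $\mathcal L_t$-sentences such that for every space $X$: $X\in\mathsf K$ iff all sentences of $\Gamma$ are true in $X$. It is *$\mathcal L_t$-definable without equality of opens* if $\Gamma$ can moreover be chosen so that no atomic formula $U=V$ occurs in its members. The *Alexandroff extension* $X^*$ of a space $X$ is the set of all ultrafilters on $X$ with the topology generated by the sets $\{\mathfrak u:\mathcal F\subseteq\mathfrak u\}$, where $\mathcal F$ is a filter on $X$ that contains the interior of each of its members. **Theorem.** 1. The formula $\Box(\Box(p\to\Box p)\to p)\to\Box p$ (Grz) defines the class of HI spaces; in particular this class is modally definable. 2. The class of HI spaces is not $\mathcal L_t$-definable. 3. If a class $\mathsf K$ of spaces is modally definable and $\mathcal L_t$-definable without equality of opens, then $X^*\in\mathsf K$ for every $X\in\mathsf K$. 4. Let $X$ be $\mathbb N$ with the Alexandroff topology of the order $\ge$, i.e. its open sets are the downward closed sets of $(\mathbb N,\le)$.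 Then $X$ is HI, but $X^*$ is not HI. -/

import Mathlib

universe u v

namespace TopoModal

/-- A class of topological spaces with carriers in `Type u`. Spaces are non-empty throughout: only the
values of `K` at non-empty spaces matter, see `ModallyDefines` and `LtDefinable`. -/
abbrev SpaceClass := (X : Type u) → [TopologicalSpace X] → Prop

/-! ### The basic modal language -/

/-- Formulas of the basic modal language over the propositional letters `P`. -/
inductive ML (P : Type v) : Type v
  | top : ML P
  | letter (p : P) : ML P
  | and (φ ψ : ML P) : ML P
  | neg (φ : ML P) : ML P
  | box (φ : ML P) : ML P

namespace ML

variable {P : Type v}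

/-- The usual abbreviation of `φ → ψ` as `¬ (φ ∧ ¬ ψ)`. -/
def imp (φ ψ : ML P) : ML P := neg (and φ (neg ψ))

/-- Truth of a modal formula at a point of the topological model `(X, ν)`. -/
def Holds {X : Type u} [TopologicalSpace X] (ν : P → Set X) : ML P → X → Prop
  | top, _ => True
  | letter p, w => w ∈ ν p
  | and φ ψ, w => Holds ν φ w ∧ Holds ν ψ w
  | neg φ, w => ¬ Holds ν φ w
  | box φ, w => ∃ O : Set X, IsOpen O ∧ w ∈ O ∧ ∀ v ∈ O, Holds ν φ v

/-- `φ` is valid in the space `X`: it is true at every point under every valuation. -/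
def Valid (φ : ML P) (X : Type u) [TopologicalSpace X] : Prop :=
  ∀ (ν : P → Set X) (w : X), Holds ν φ w

/-- The Grzegorczyk formula `□(□(p → □p) → p) → □p`. -/
def grz (p : P) : ML P :=
  imp (box (imp (box (imp (letter p) (box (letter p)))) (letter p))) (box (letter p))

end ML

/-- The set `Γ` of modal formulas (over countably many letters) defines the class `K`. -/
def ModallyDefines (Γ : Set (ML ℕ)) (K : SpaceClass.{u}) : Prop :=
  ∀ (X : Type u) [TopologicalSpace X] [Nonempty X], K X ↔ ∀ φ ∈ Γ, φ.Valid X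

/-- The class `K` is modally definable. -/
def ModallyDefinable (K : SpaceClass.{u}) : Prop :=
  ∃ Γ : Set (ML ℕ), ModallyDefines Γ K

/-! ### The two-sorted language `L²` and its fragment `L_t` -/

/-- Formulas of the two-sorted first-order language `L²` with a unary predicate for each `p : P`.
Point variables and open variables are both named by natural numbers. -/
inductive L2 (P : Type v) : Type v
  | top : L2 P
  /-- `x = y` for point variables -/
  | eqPt (x y : ℕ) : L2 P
  /-- `U = V` for open variables -/
  | eqOp (U V : ℕ) : L2 P
  /-- `P_p(x)` -/
  | pred (p : P) (x : ℕ) : L2 P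
  /-- `x ε U` -/
  | mem (x U : ℕ) : L2 P
  | neg (φ : L2 P) : L2 P
  | and (φ ψ : L2 P) : L2 P
  /-- `∃ x. φ` for a point variable `x` -/
  | exPt (x : ℕ) (φ : L2 P) : L2 P
  /-- `∃ U. φ` for an open variable `U` -/
  | exOp (U : ℕ) (φ : L2 P) : L2 P

namespace L2

variable {P : Type v}

/-- The usual abbreviation of `φ → ψ` as `¬ (φ ∧ ¬ ψ)`. -/
def imp (φ ψ : L2 P) : L2 P := neg (and φ (neg ψ))

/-- The usual abbreviation of `∀ U. φ` as `¬ ∃ U. ¬ φ`. -/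
def allOp (U : ℕ) (φ : L2 P) : L2 P := neg (exOp U (neg φ))

/-- Free point variables. -/
def freePt : L2 P → Set ℕ
  | top => ∅
  | eqPt x y => {x, y}
  | eqOp _ _ => ∅
  | pred _ x => {x}
  | mem x _ => {x}
  | neg φ => freePt φ
  | and φ ψ => freePt φ ∪ freePt ψ
  | exPt x φ => freePt φ \ {x}
  | exOp _ φ => freePt φ

/-- Free open variables. -/
def freeOp : L2 P → Set ℕ
  | top => ∅
  | eqPt _ _ => ∅
  | eqOp U V => {U, V}
  | pred _ _ => ∅
  | mem _ U => {U}
  | neg φ => freeOp φ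
  | and φ ψ => freeOp φ ∪ freeOp ψ
  | exPt _ φ => freeOp φ
  | exOp U φ => freeOp φ \ {U}

/-- A sentence has no free variables of either sort. -/
def IsSentence (φ : L2 P) : Prop := φ.freePt = ∅ ∧ φ.freeOp = ∅

/-- `Polar U φ true` (`Polar U φ false`): every free occurrence of the open variable `U` in `φ` is under
an even (odd) number of negation signs. -/
def Polar (U : ℕ) : L2 P → Bool → Prop
  | top, _ => True
  | eqPt _ _, _ => True
  | eqOp V W, b => (V = U ∨ W = U) → b = true
  | pred _ _, _ => True
  | mem _ V, b => V = U → b = true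
  | neg φ, b => Polar U φ (!b)
  | and φ ψ, b => Polar U φ b ∧ Polar U ψ b
  | exPt _ φ, b => Polar U φ b
  | exOp V φ, b => V = U ∨ Polar U φ b

/-- `φ` is positive in the open variable `U`. -/
def PositiveIn (U : ℕ) (φ : L2 P) : Prop := φ.Polar U true

/-- `φ` is negative in the open variable `U`. -/
def NegativeIn (U : ℕ) (φ : L2 P) : Prop := φ.Polar U false

/-- The formulas of `L_t`. -/
inductive IsLt : L2 P → Prop
  | top : IsLt top
  | eqPt (x y : ℕ) : IsLt (eqPt x y)
  | eqOp (U V : ℕ) : IsLt (eqOp U V)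
  | pred (p : P) (x : ℕ) : IsLt (pred p x)
  | mem (x U : ℕ) : IsLt (mem x U)
  | neg {φ : L2 P} : IsLt φ → IsLt (neg φ)
  | and {φ ψ : L2 P} : IsLt φ → IsLt ψ → IsLt (and φ ψ)
  | exPt (x : ℕ) {φ : L2 P} : IsLt φ → IsLt (exPt x φ)
  | allOp (x U : ℕ) {φ : L2 P} : IsLt φ → PositiveIn U φ → IsLt (allOp U (imp (mem x U) φ))
  | exOp (x U : ℕ) {φ : L2 P} : IsLt φ → NegativeIn U φ → IsLt (exOp U (and (mem x U) φ))

/-- No equation `U = V` between open variables occurs in the formula. -/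
def NoOpenEq : L2 P → Prop
  | top => True
  | eqPt _ _ => True
  | eqOp _ _ => False
  | pred _ _ => True
  | mem _ _ => True
  | neg φ => NoOpenEq φ
  | and φ ψ => NoOpenEq φ ∧ NoOpenEq ψ
  | exPt _ φ => NoOpenEq φ
  | exOp _ φ => NoOpenEq φ

/-- Satisfaction of an `L²`-formula, with open variables ranging over the family `σ` of subsets of `X`,
predicates interpreted by `ν`, under the assignments `g` (points) and `h` (members of `σ`). -/
def Sat {X : Type u} (σ : Set (Set X)) (ν : P → Set X) : L2 P → (ℕ → X) → (ℕ → Set X) → Prop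
  | top, _, _ => True
  | eqPt x y, g, _ => g x = g y
  | eqOp U V, _, h => h U = h V
  | pred p x, g, _ => g x ∈ ν p
  | mem x U, g, h => g x ∈ h U
  | neg φ, g, h => ¬ Sat σ ν φ g h
  | and φ ψ, g, h => Sat σ ν φ g h ∧ Sat σ ν ψ g h
  | exPt x φ, g, h => ∃ a : X, Sat σ ν φ (Function.update g x a) h
  | exOp U φ, g, h => ∃ O ∈ σ, Sat σ ν φ g (Function.update h U O)

/-- Truth in a topological space of a sentence of the signature without unary predicates; open
variables range over all open sets. -/
def TrueIn (φ : L2 Empty) (X : Type u) [TopologicalSpace X] : Prop :=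
  ∀ (g : ℕ → X) (h : ℕ → Set X), (∀ n, IsOpen (h n)) →
    Sat {O : Set X | IsOpen O} (fun p : Empty => p.elim) φ g h

end L2

/-- The set `Γ` of sentences defines the class `K`. -/
def SentencesDefine (Γ : Set (L2 Empty)) (K : SpaceClass.{u}) : Prop :=
  (∀ φ ∈ Γ, φ.IsSentence) ∧
    ∀ (X : Type u) [TopologicalSpace X] [Nonempty X], K X ↔ ∀ φ ∈ Γ, φ.TrueIn X

/-- The class `K` is defined by a set of `L_t`-sentences. -/
def LtDefinable (K : SpaceClass.{u}) : Prop :=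
  ∃ Γ : Set (L2 Empty), (∀ φ ∈ Γ, φ.IsLt) ∧ SentencesDefine Γ K

/-- The class `K` is defined by a set of `L_t`-sentences without equations between open variables. -/
def LtDefinableNoOpenEq (K : SpaceClass.{u}) : Prop :=
  ∃ Γ : Set (L2 Empty), (∀ φ ∈ Γ, φ.IsLt ∧ φ.NoOpenEq) ∧ SentencesDefine Γ K

/-! ### Hereditarily irresolvable spaces and Alexandroff extensions -/

/-- `X` cannot be decomposed into two disjoint dense subsets. -/
def Irresolvable (X : Type u) [TopologicalSpace X] : Prop :=
  ¬ ∃ A B : Set X, Dense A ∧ Dense B ∧ Disjoint A B ∧ A ∪ B = Set.univ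

/-- All (non-empty) subspaces of `X` are irresolvable. -/
def HereditarilyIrresolvable : SpaceClass.{u} := fun X _ =>
  ∀ S : Set X, S.Nonempty → Irresolvable S

/-- A filter on a space is open if it contains the interior of each of its members. -/
def IsOpenFilter {X : Type u} [TopologicalSpace X] (F : Filter X) : Prop :=
  ∀ A ∈ F, interior A ∈ F

/-- The carrier of the Alexandroff extension of `X`: the set of ultrafilters on `X`. This is a synonym
because `Ultrafilter X` carries another topology in the library. -/
def AlexandroffExtension (X : Type u) : Type u := Ultrafilter X

/-- The topology generated by the sets of all ultrafilters that contain a given open filter. -/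
instance (X : Type u) [TopologicalSpace X] : TopologicalSpace (AlexandroffExtension X) :=
  TopologicalSpace.generateFrom
    {S : Set (Ultrafilter X) | ∃ F : Filter X, IsOpenFilter F ∧ S = {w | ∀ A ∈ F, A ∈ w}}

end TopoModal

open TopoModal

/-!
All four parts rest on one description: a space is hereditarily irresolvable iff it has no disjoint
non-empty sets `A`, `B` each contained in the closure of the other
(`hereditarilyIrresolvable_iff`). A valuation that refutes the Grzegorczyk formula yields such a pair
and conversely. In `ℕ` with the topology of down-sets, the least element of `A ∪ B` is isolated in
`A ∪ B`. In its Alexandroff extension, the only open filter contained in a free ultrafilter is the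
trivial one, so any two free ultrafilters are topologically indistinguishable.

For the failure of `L_t`-definability, consider spaces whose non-empty open sets are the members of a
filter `F`. If `F` is a free ultrafilter the space is hereditarily irresolvable; if `F` is the
intersection of two free ultrafilters it is resolvable. A back-and-forth argument shows that the two
spaces satisfy the same `L_t`-sentences (`L2.IsLt.trueIn_filterTopology`). A given open set is answered
by a small one, which is all that matters as its variable occurs with one polarity only; the answer can
be taken so small that infinitely many points of every kind remain outside, which keeps later moves
possible and makes different answers distinct, so that equations between open variables are handled as
well. All that is used about the filters is that they are thin (`IsThin`).

For the closure under Alexandroff extensions, let `X` be a member of the class. The extension `X*` is the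
image under a continuous open surjection of a space `X'` that satisfies all `L_t`-sentences without
equations between open variables that are true in `X`; hence `X'` is in the class, and so is `X*`, as
modal validity passes to such images (`ML.Valid.of_surjective`). The map sends a point of `X'` to the
ultrafilter of all `A ⊆ X` whose extension to `X'` contains the point. Its openness requires that, for
every basic open set `U` of `X'`, an ultrafilter all of whose members meet `U` be realized by a point of
`U`. A single ultrapower has this saturation property only for special ultrafilters, so `X'` is the union
of an `ω`-chain of ultrapowers, in which types over one stage are realized in the next one
(`LimitPower.exists_mem_of_inter_nonempty`). The chain is presented in one step, as functions of finitely
many terms of a sequence, modulo an ultrafilter on the set of sequences that extends all iterated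
products of the given ultrafilter (`limitUltrafilter`). The topology of `X'` is generated by the internal
open sets; Łoś's theorem holds for quantification over these (`LimitPower.sat_internalOpens_iff`), and
`L_t`-formulas do not distinguish a base from the full topology (`L2.IsLt.sat_basis_iff`).
-/

namespace TopoModal

/-! ### Hereditarily irresolvable spaces and the Grzegorczyk formula -/

/-- Hereditary irresolvability in terms of closures in the whole space. -/
theorem hereditarilyIrresolvable_iff {X : Type u} [TopologicalSpace X] :
    HereditarilyIrresolvable X ↔
      ∀ A B : Set X, Disjoint A B → A ⊆ closure B → B ⊆ closure A → A = ∅ := by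
  constructor
  · intro h A B hd hA hB
    by_contra hne
    obtain ⟨a, ha⟩ := Set.nonempty_iff_ne_empty.2 hne
    refine h (A ∪ B) ⟨a, Or.inl ha⟩ ⟨Subtype.val ⁻¹' A, Subtype.val ⁻¹' B, ?_, ?_, ?_, ?_⟩
    · rw [Subtype.dense_iff, Subtype.image_preimage_coe,
        Set.inter_eq_self_of_subset_right Set.subset_union_left]
      exact Set.union_subset subset_closure hB
    · rw [Subtype.dense_iff, Subtype.image_preimage_coe,
        Set.inter_eq_self_of_subset_right Set.subset_union_right]
      exact Set.union_subset hA subset_closure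
    · exact hd.preimage _
    · ext ⟨x, hx⟩
      simpa using hx
  · rintro h S ⟨s, hs⟩ ⟨A, B, hA, hB, hd, -⟩
    have key := h (Subtype.val '' A) (Subtype.val '' B)
      ((Set.disjoint_image_iff Subtype.val_injective).2 hd)
      ((Subtype.coe_image_subset S A).trans (Subtype.dense_iff.1 hB))
      ((Subtype.coe_image_subset S B).trans (Subtype.dense_iff.1 hA))
    rw [Set.image_eq_empty] at key
    have : Nonempty S := ⟨⟨s, hs⟩⟩
    exact hA.nonempty.ne_empty key

namespace ML

variable {P : Type v} {X : Type u} [TopologicalSpace X]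

theorem holds_imp (ν : P → Set X) (φ ψ : ML P) (w : X) :
    Holds ν (imp φ ψ) w ↔ (Holds ν φ w → Holds ν ψ w) := by
  simp [imp, Holds]

theorem holds_box (ν : P → Set X) (φ : ML P) (w : X) :
    Holds ν (box φ) w ↔ w ∈ interior {v | Holds ν φ v} := by
  simp only [Holds, mem_interior]
  exact ⟨fun ⟨O, hO, hw, h⟩ => ⟨O, h, hO, hw⟩, fun ⟨O, h, hO, hw⟩ => ⟨O, hO, hw, h⟩⟩

theorem holds_letter (ν : P → Set X) (p : P) (w : X) : Holds ν (letter p) w ↔ w ∈ ν p := Iff.rfl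

end ML

theorem valid_grz_iff_hereditarilyIrresolvable {P : Type v} (p : P) (X : Type u)
    [TopologicalSpace X] : (ML.grz p).Valid X ↔ HereditarilyIrresolvable X := by
  rw [hereditarilyIrresolvable_iff]
  simp only [ML.Valid, ML.grz, ML.holds_imp, ML.holds_box, ML.holds_letter, Set.ofPred_mem_eq]
  constructor
  · intro h A B hd hA hB
    by_contra hne
    obtain ⟨a, ha⟩ := Set.nonempty_iff_ne_empty.2 hne
    -- with `p` interpreted as the complement of `A`, the antecedent holds everywhere
    have key := h (fun _ => Aᶜ) a ?_
    · exact interior_subset key ha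
    convert Set.mem_univ a
    rw [interior_eq_univ, Set.eq_univ_iff_forall]
    intro v hv hvA
    obtain ⟨b, hb, hbB⟩ := mem_closure_iff.1 (hA hvA) _ isOpen_interior hv
    have hbA : b ∈ interior Aᶜ := interior_subset hb (hd.notMem_of_mem_right hbB)
    rw [interior_compl] at hbA
    exact hbA (hB hbB)
  · intro h ν w hw
    obtain ⟨O, hO, hOo, hwO⟩ := mem_interior.1 hw
    have key := h (O \ ν p) ((O ∩ ν p) \ interior (ν p)) ?_ ?_ ?_
    · exact mem_interior.2 ⟨O, Set.sdiff_eq_empty.1 key, hOo, hwO⟩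
    · exact Set.disjoint_left.2 fun x hx hy => hx.2 hy.1.2
    · rintro x ⟨hxO, hxp⟩
      have h1 : x ∉ interior {v | v ∈ ν p → v ∈ interior (ν p)} := fun h => hxp (hO hxO h)
      rw [mem_closure_iff]
      intro V hV hxV
      by_contra hne
      refine h1 (mem_interior.2 ⟨V ∩ O, fun y hy hyp => ?_, hV.inter hOo, hxV, hxO⟩)
      by_contra hyi
      exact hne ⟨y, hy.1, ⟨hy.2, hyp⟩, hyi⟩
    · rintro x ⟨⟨hxO, -⟩, hxi⟩
      rw [mem_closure_iff]
      intro V hV hxV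
      by_contra hne
      refine hxi (mem_interior.2 ⟨V ∩ O, fun y hy => ?_, hV.inter hOo, hxV, hxO⟩)
      by_contra hyp
      exact hne ⟨y, hy.1, hy.2, hyp⟩

/-! ### The natural numbers with the topology of down-sets -/

theorem hereditarilyIrresolvable_withLowerSet_nat :
    HereditarilyIrresolvable (Topology.WithLowerSet ℕ) := by
  rw [hereditarilyIrresolvable_iff]
  intro A B hd hA hB
  by_contra hne
  have hne := Set.nonempty_iff_ne_empty.2 hne
  have hwf : WellFounded (fun a b : Topology.WithLowerSet ℕ => a < b) :=
    (wellFounded_lt : WellFounded (fun a b : ℕ => a < b))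
  have hO : ∀ m : Topology.WithLowerSet ℕ, IsOpen (Set.Iic m) := fun m =>
    Topology.IsLowerSet.isOpen_iff_isLowerSet.2 (isLowerSet_Iic m)
  -- the least element of `A ∪ B` is isolated in `A ∪ B`, so it lies in both `A` and `B`
  obtain ⟨m, hm, hmin⟩ := hwf.has_min (A ∪ B) (hne.mono Set.subset_union_left)
  have hle : ∀ x ∈ A ∪ B, x ≤ m → x = m := fun x hx hxm =>
    by_contra fun hne => hmin x hx (lt_of_le_of_ne (α := ℕ) hxm hne)
  rcases hm with hm | hm
  · obtain ⟨b, hb, hbB⟩ := mem_closure_iff.1 (hA hm) _ (hO m) (Set.mem_Iic.2 le_rfl)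
    rw [hle b (Or.inr hbB) hb] at hbB
    exact Set.disjoint_left.1 hd hm hbB
  · obtain ⟨b, hb, hbA⟩ := mem_closure_iff.1 (hB hm) _ (hO m) (Set.mem_Iic.2 le_rfl)
    rw [hle b (Or.inl hbA) hb] at hbA
    exact Set.disjoint_left.1 hd hbA hm

theorem _root_.Set.Infinite.exists_subset_infinite_diff_infinite {α : Type u} {T : Set α}
    (hT : T.Infinite) : ∃ A ⊆ T, A.Infinite ∧ (T \ A).Infinite := by
  obtain ⟨A, B, hAB, hd, hc⟩ := hT.exists_union_disjoint_cardinal_eq_of_infinite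
  have hiff : A.Infinite ↔ B.Infinite := by
    rw [← Set.infinite_coe_iff, ← Set.infinite_coe_iff, Cardinal.infinite_iff, Cardinal.infinite_iff,
      hc]
  have hB : T \ A = B := by
    rw [← hAB, Set.union_sdiff_left, hd.sdiff_eq_right]
  rw [← hAB, Set.infinite_union, hiff, or_self] at hT
  exact ⟨A, hAB ▸ Set.subset_union_left, hiff.2 hT, hB ▸ hT⟩

theorem _root_.Set.Infinite.exists_ultrafilter {α : Type u} {T : Set α} (hT : T.Infinite) :
    ∃ U : Ultrafilter α, T ∈ U ∧ (U : Filter α) ≤ Filter.cofinite := by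
  have : (Filter.cofinite ⊓ Filter.principal T).NeBot := Filter.cofinite_inf_principal_neBot_iff.2 hT
  obtain ⟨U, hU⟩ := Ultrafilter.exists_le (Filter.cofinite ⊓ Filter.principal T)
  exact ⟨U, Filter.le_principal_iff.1 (hU.trans inf_le_right), hU.trans inf_le_left⟩

theorem exists_ne_ultrafilter_le_cofinite (α : Type u) [Infinite α] :
    ∃ (A : Set α) (U V : Ultrafilter α), A ∈ U ∧ Aᶜ ∈ V ∧
      (U : Filter α) ≤ Filter.cofinite ∧ (V : Filter α) ≤ Filter.cofinite := by
  obtain ⟨A, -, hA, hA'⟩ := (Set.infinite_univ (α := α)).exists_subset_infinite_diff_infinite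
  rw [← Set.compl_eq_univ_sdiff] at hA'
  obtain ⟨U, hAU, hU⟩ := hA.exists_ultrafilter
  obtain ⟨V, hAV, hV⟩ := hA'.exists_ultrafilter
  exact ⟨A, U, V, hAU, hAV, hU, hV⟩

/-- A free ultrafilter belongs to no proper open subset of the Alexandroff extension of `ℕ` with the
topology of down-sets, as `ℕ` is the only infinite down-set. -/
theorem nhds_alexandroffExtension_eq_top
    (w : AlexandroffExtension (Topology.WithLowerSet ℕ))
    (hw : Ultrafilter.toFilter (α := Topology.WithLowerSet ℕ) w ≤ Filter.cofinite) :
    nhds w = ⊤ := by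
  refine (TopologicalSpace.nhds_generateFrom).trans ?_
  rw [eq_top_iff]
  refine le_iInf₂ fun S hS => ?_
  obtain ⟨hwS, F, hF, rfl⟩ := hS
  refine Filter.le_principal_iff.2 (Filter.mem_top.2 (Set.eq_univ_iff_forall.2 fun v A hA => ?_))
  have h1 : interior A ∈ Ultrafilter.toFilter (α := Topology.WithLowerSet ℕ) w :=
    hwS _ (hF A hA)
  have h2 : IsLowerSet (interior A) := Topology.IsLowerSet.isOpen_iff_isLowerSet.1 isOpen_interior
  suffices hAu : A = Set.univ by
    rw [hAu]
    exact Filter.univ_mem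
  rw [Set.eq_univ_iff_forall]
  intro n
  -- `interior A` cannot be contained in the finite set of the elements below `n`
  have hfin : (Set.Iio n).Finite := Set.finite_Iio (α := ℕ) n
  obtain ⟨m, hm, hmA⟩ := Ultrafilter.nonempty_of_mem (α := Topology.WithLowerSet ℕ) (f := w)
    (Filter.inter_mem (hw hfin.compl_mem_cofinite) h1)
  exact interior_subset (h2 (Nat.le_of_not_lt hm) hmA)

theorem not_hereditarilyIrresolvable_alexandroffExtension :
    ¬ HereditarilyIrresolvable (AlexandroffExtension (Topology.WithLowerSet ℕ)) := by
  rw [hereditarilyIrresolvable_iff]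
  intro h
  have : Infinite (Topology.WithLowerSet ℕ) := inferInstanceAs (Infinite ℕ)
  obtain ⟨A, U, V, hU, hV, hUf, hVf⟩ :=
    exists_ne_ultrafilter_le_cofinite (Topology.WithLowerSet ℕ)
  let U' : AlexandroffExtension (Topology.WithLowerSet ℕ) := U
  let V' : AlexandroffExtension (Topology.WithLowerSet ℕ) := V
  have hne : U' ≠ V' := by
    intro heq
    have : Aᶜ ∈ U := by
      rw [show U = V from heq]
      exact hV
    exact Ultrafilter.compl_mem_iff_notMem.1 this hU
  refine Set.singleton_ne_empty U' (h {U'} {V'} (Set.disjoint_singleton.2 hne) ?_ ?_)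
  · rw [Set.singleton_subset_iff, mem_closure_iff_nhds, nhds_alexandroffExtension_eq_top U' hUf]
    intro t ht
    rw [Filter.mem_top.1 ht]
    simp
  · rw [Set.singleton_subset_iff, mem_closure_iff_nhds, nhds_alexandroffExtension_eq_top V' hVf]
    intro t ht
    rw [Filter.mem_top.1 ht]
    simp

/-! ### Satisfaction of relativised quantifiers -/

namespace L2

variable {P : Type v} {X : Type u} {σ : Set (Set X)} {ν : P → Set X} {φ : L2 P} {x U V : ℕ}
  {g : ℕ → X} {h : ℕ → Set X}

theorem sat_allOp_imp :
    Sat σ ν (allOp U (imp (mem x U) φ)) g h ↔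
      ∀ O ∈ σ, g x ∈ O → Sat σ ν φ g (Function.update h U O) := by
  simp [allOp, imp, Sat]

theorem sat_exOp_and :
    Sat σ ν (exOp U (and (mem x U) φ)) g h ↔
      ∃ O ∈ σ, g x ∈ O ∧ Sat σ ν φ g (Function.update h U O) := by
  simp [Sat]

theorem polar_of_polar_allOp_imp {b : Bool} (hV : V ≠ U)
    (hp : (allOp U (imp (mem x U) φ)).Polar V b) : φ.Polar V b := by
  simpa [allOp, imp, Polar, hV.symm] using hp

theorem polar_of_polar_exOp_and {b : Bool} (hV : V ≠ U)
    (hp : (exOp U (and (mem x U) φ)).Polar V b) : φ.Polar V b := by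
  simpa [Polar, hV.symm] using hp

end L2

/-! ### Spaces whose non-empty open sets form a filter -/

/-- The topology whose non-empty open sets are the members of the filter `F`. -/
@[reducible]
def filterTopology {α : Type u} (F : Filter α) : TopologicalSpace α where
  IsOpen O := O.Nonempty → O ∈ F
  isOpen_univ _ := Filter.univ_mem
  isOpen_inter _ _ hA hB h := Filter.inter_mem (hA h.left) (hB h.right)
  isOpen_sUnion S hS h := by
    obtain ⟨x, A, hA, hx⟩ := h
    exact Filter.mem_of_superset (hS A hA ⟨x, hx⟩) (Set.subset_sUnion_of_mem hA)

/-- A set outside the ultrafilter is closed, and of two disjoint sets one is outside. -/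
theorem hereditarilyIrresolvable_filterTopology {α : Type u} (F : Ultrafilter α) :
    @HereditarilyIrresolvable α (filterTopology (F : Filter α)) := by
  let _ := filterTopology (F : Filter α)
  rw [hereditarilyIrresolvable_iff]
  have key : ∀ A B : Set α, Disjoint A B → A ⊆ closure B → B ∉ F → A = ∅ := by
    intro A B hd hA hB
    by_contra hne
    obtain ⟨a, ha⟩ := Set.nonempty_iff_ne_empty.2 hne
    have hO : IsOpen Bᶜ := fun _ => Ultrafilter.compl_mem_iff_notMem.2 hB
    obtain ⟨b, hb, hbB⟩ := mem_closure_iff.1 (hA ha) _ hO (Set.disjoint_left.1 hd ha)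
    exact hb hbB
  intro A B hd hA hB
  by_cases hBF : B ∈ F
  · have hAF : A ∉ F := fun hAF => by
      obtain ⟨x, hx⟩ := Ultrafilter.nonempty_of_mem (Filter.inter_mem hAF hBF)
      exact Set.disjoint_left.1 hd hx.1 hx.2
    have hB0 := key B A hd.symm hB hAF
    rw [hB0] at hBF
    exact (Ultrafilter.empty_notMem hBF).elim
  · exact key A B hd hA hBF

theorem not_hereditarilyIrresolvable_filterTopology_sup {α : Type u} {U V : Ultrafilter α}
    {A : Set α} (hU : A ∈ U) (hV : Aᶜ ∈ V) :
    ¬ @HereditarilyIrresolvable α (filterTopology ((U : Filter α) ⊔ V)) := by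
  let _ := filterTopology ((U : Filter α) ⊔ V)
  rw [hereditarilyIrresolvable_iff]
  intro h
  refine (Ultrafilter.nonempty_of_mem hU).ne_empty (h A Aᶜ disjoint_compl_right ?_ ?_)
  · refine fun a _ => mem_closure_iff.2 fun O hO ha => ?_
    exact Ultrafilter.nonempty_of_mem (Filter.inter_mem (hO ⟨a, ha⟩).2 hV)
  · refine fun a _ => mem_closure_iff.2 fun O hO ha => ?_
    exact Ultrafilter.nonempty_of_mem (Filter.inter_mem (hO ⟨a, ha⟩).1 hU)

/-- A proper free filter is *thin* if it does not restrict to the cofinite filter on any infinite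
set. In the space defined by a thin filter every open set can be shrunk so as to lose infinitely many
points of a given infinite set. -/
structure IsThin {α : Type u} (F : Filter α) : Prop where
  neBot : F.NeBot
  le_cofinite : F ≤ Filter.cofinite
  exists_infinite_diff : ∀ T : Set α, T.Infinite → ∃ O ∈ F, (T \ O).Infinite

theorem IsThin.of_ultrafilter {α : Type u} {U : Ultrafilter α}
    (hU : (U : Filter α) ≤ Filter.cofinite) : IsThin (U : Filter α) where
  neBot := U.neBot
  le_cofinite := hU
  exists_infinite_diff T hT := by
    obtain ⟨A, hAT, hA, hTA⟩ := hT.exists_subset_infinite_diff_infinite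
    by_cases h : A ∈ U
    · exact ⟨A, h, hTA⟩
    · refine ⟨Aᶜ, Ultrafilter.compl_mem_iff_notMem.2 h, ?_⟩
      rwa [Set.sdiff_compl, Set.inter_eq_self_of_subset_right hAT]

theorem IsThin.sup {α : Type u} {F G : Filter α} (hF : IsThin F) (hG : IsThin G) :
    IsThin (F ⊔ G) where
  neBot := hF.neBot.mono le_sup_left
  le_cofinite := sup_le hF.le_cofinite hG.le_cofinite
  exists_infinite_diff T hT := by
    obtain ⟨O, hO, hTO⟩ := hF.exists_infinite_diff T hT
    obtain ⟨O', hO', hTO'⟩ := hG.exists_infinite_diff _ hTO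
    refine ⟨O ∪ O', Filter.union_mem_sup hO hO', ?_⟩
    rwa [← Set.sdiff_sdiff]

theorem IsThin.infinite_of_mem {α : Type u} {F : Filter α} (hF : IsThin F) {O : Set α}
    (hO : O ∈ F) : O.Infinite := by
  have := hF.neBot
  intro hfin
  obtain ⟨x, hx, hx'⟩ :=
    Filter.nonempty_of_mem (Filter.inter_mem hO (hF.le_cofinite hfin.compl_mem_cofinite))
  exact hx' hx

theorem IsThin.exists_infinite_diff_forall {α : Type u} {F : Filter α} (hF : IsThin F)
    {𝒯 : Set (Set α)} (hfin : 𝒯.Finite) (hinf : ∀ T ∈ 𝒯, T.Infinite) :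
    ∃ O ∈ F, ∀ T ∈ 𝒯, (T \ O).Infinite := by
  have h : ∀ T : Set α, ∃ O ∈ F, T ∈ 𝒯 → (T \ O).Infinite := fun T => by
    by_cases hT : T ∈ 𝒯
    · obtain ⟨O, hO, h⟩ := hF.exists_infinite_diff T (hinf T hT)
      exact ⟨O, hO, fun _ => h⟩
    · exact ⟨Set.univ, Filter.univ_mem, fun h => (hT h).elim⟩
  choose O hO hTO using h
  exact ⟨⋂ T ∈ 𝒯, O T, (Filter.biInter_mem hfin).2 fun T _ => hO T, fun T hT =>
    (hTO T hT).mono (Set.sdiff_subset_sdiff_right (Set.biInter_subset_of_mem hT))⟩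

/-! ### A back-and-forth argument for `L_t` -/

/-- The points `a` and `b` are compatible with the pairs of open sets chosen so far: `P` collects the
pairs whose left component was given and whose right component was the answer, `Q` those where it was
the other way round. A point of an answer must correspond to a point of the given set. -/
def Compatible {α : Type u} (P Q : Set (Set α × Set α)) (a b : α) : Prop :=
  (∀ p ∈ P, b ∈ p.2 → a ∈ p.1) ∧ ∀ q ∈ Q, a ∈ q.1 → b ∈ q.2

/-- A position of the back-and-forth game between the spaces of the filters `F` and `G`: finitely many
pairs `E` of corresponding points, and pairs of corresponding open sets as in `Compatible`. -/
structure IsPosition {α : Type u} (F G : Filter α) (E : Set (α × α)) (P Q : Set (Set α × Set α)) :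
    Prop where
  finite_points : E.Finite
  finite_left : P.Finite
  finite_right : Q.Finite
  fst_eq_iff : ∀ d ∈ E, ∀ e ∈ E, d.1 = e.1 ↔ d.2 = e.2
  mem_left : ∀ p ∈ P, p.1 ∈ F ∧ p.2 ∈ G
  mem_right : ∀ q ∈ Q, q.1 ∈ F ∧ q.2 ∈ G
  fst_eq_of_snd_eq : ∀ p ∈ P, ∀ q ∈ P, p.2 = q.2 → p.1 = q.1
  snd_eq_of_fst_eq : ∀ p ∈ Q, ∀ q ∈ Q, p.1 = q.1 → p.2 = q.2
  compatible : ∀ e ∈ E, Compatible P Q e.1 e.2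
  forth : ∀ a, (∀ e ∈ E, e.1 ≠ a) → {b | Compatible P Q a b}.Infinite
  back : ∀ b, (∀ e ∈ E, e.2 ≠ b) → {a | Compatible P Q a b}.Infinite

theorem compatible_swap {α : Type u} {P Q : Set (Set α × Set α)} {a b : α} :
    Compatible (Prod.swap ⁻¹' Q) (Prod.swap ⁻¹' P) b a ↔ Compatible P Q a b := by
  simp only [Compatible, Set.mem_preimage, Prod.forall, Prod.swap_prod_mk]
  exact ⟨fun h => ⟨fun O O' hO => h.2 O' O hO, fun O O' hO => h.1 O' O hO⟩,
    fun h => ⟨fun O O' hO => h.2 O' O hO, fun O O' hO => h.1 O' O hO⟩⟩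

namespace IsPosition

variable {α : Type u} {F G : Filter α} {E : Set (α × α)} {P Q : Set (Set α × Set α)}

theorem swap (h : IsPosition F G E P Q) :
    IsPosition G F (Prod.swap ⁻¹' E) (Prod.swap ⁻¹' Q) (Prod.swap ⁻¹' P) where
  finite_points := h.finite_points.preimage Prod.swap_injective.injOn
  finite_left := h.finite_right.preimage Prod.swap_injective.injOn
  finite_right := h.finite_left.preimage Prod.swap_injective.injOn
  fst_eq_iff d hd e he := (h.fst_eq_iff _ hd _ he).symm
  mem_left p hp := (h.mem_right _ hp).symm
  mem_right p hp := (h.mem_left _ hp).symm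
  fst_eq_of_snd_eq p hp q hq := h.snd_eq_of_fst_eq _ hp _ hq
  snd_eq_of_fst_eq p hp q hq := h.fst_eq_of_snd_eq _ hp _ hq
  compatible e he := compatible_swap.2 (h.compatible _ he)
  forth b hb := by
    simp only [compatible_swap]
    exact h.back b fun e he => hb e.swap (by simpa using he)
  back a ha := by
    simp only [compatible_swap]
    exact h.forth a fun e he => ha e.swap (by simpa using he)

theorem exists_point (h : IsPosition F G E P Q) (a : α) :
    ∃ b E', E ⊆ E' ∧ (a, b) ∈ E' ∧ IsPosition F G E' P Q := by
  by_cases ha : ∃ e ∈ E, e.1 = a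
  · obtain ⟨e, he, rfl⟩ := ha
    exact ⟨e.2, E, subset_rfl, he, h⟩
  have ha : ∀ e ∈ E, e.1 ≠ a := fun e he hea => ha ⟨e, he, hea⟩
  obtain ⟨b, hb, hbE⟩ := ((h.forth a ha).sdiff (h.finite_points.image Prod.snd)).nonempty
  have hb' : ∀ e ∈ E, e.2 ≠ b := fun e he heb => hbE ⟨e, he, heb⟩
  refine ⟨b, insert (a, b) E, Set.subset_insert _ _, Set.mem_insert _ _,
    { h with
      finite_points := h.finite_points.insert _
      fst_eq_iff := ?_
      compatible := ?_
      forth := fun c hc => h.forth c fun e he => hc e (Set.mem_insert_of_mem _ he)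
      back := fun c hc => h.back c fun e he => hc e (Set.mem_insert_of_mem _ he) }⟩
  · rintro d (rfl | hd) e (rfl | he)
    · simp
    · exact ⟨fun hh => (ha e he hh.symm).elim, fun hh => (hb' e he hh.symm).elim⟩
    · exact ⟨fun hh => (ha d hd hh).elim, fun hh => (hb' d hd hh).elim⟩
    · exact h.fst_eq_iff d hd e he
  · rintro e (rfl | he)
    · exact hb
    · exact h.compatible e he

/-- The set of points compatible with `a` depends only on which of the finitely many open sets
contain `a`. -/
theorem finite_range_compatible (hP : P.Finite) (hQ : Q.Finite) :
    (Set.range fun a => {b | Compatible P Q a b}).Finite := by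
  refine Set.Finite.subset (Set.Finite.image2
    (fun P' Q' : Set (Set α × Set α) => {b | (∀ p ∈ P, b ∈ p.2 → p ∈ P') ∧ ∀ q ∈ Q', b ∈ q.2})
    hP.finite_subsets hQ.finite_subsets) ?_
  rintro _ ⟨a, rfl⟩
  refine ⟨{p ∈ P | a ∈ p.1}, fun _ hp => hp.1, {q ∈ Q | a ∈ q.1}, fun _ hq => hq.1, ?_⟩
  ext b
  constructor
  · rintro ⟨h1, h2⟩
    exact ⟨fun p hp hb => (h1 p hp hb).2, fun q hq ha => h2 q ⟨hq, ha⟩⟩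
  · rintro ⟨h1, h2⟩
    exact ⟨fun p hp hb => ⟨hp, h1 p hp hb⟩, fun q hq => h2 q hq.1 hq.2⟩

theorem exists_open (hF : IsThin F) (hG : IsThin G) (h : IsPosition F G E P Q) {a b : α}
    (hab : (a, b) ∈ E) {O : Set α} (hO : O ∈ F) (ha : a ∈ O) :
    ∃ O' ∈ G, b ∈ O' ∧ IsPosition F G E (insert (O, O') P) Q := by
  -- the answer omits infinitely many points of each infinite compatibility class, so that points
  -- outside of it stay available, and of each earlier answer, so that it differs from all of them
  obtain ⟨W, hW, hTW⟩ := hG.exists_infinite_diff_forall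
    (𝒯 := {T ∈ Set.range fun a => {b | Compatible P Q a b} | T.Infinite} ∪ Prod.snd '' P)
    (((finite_range_compatible h.finite_left h.finite_right).subset fun _ hT => hT.1).union
      (h.finite_left.image _))
    (by
      rintro T (hT | ⟨p, hp, rfl⟩)
      · exact hT.2
      · exact hG.infinite_of_mem (h.mem_left p hp).2)
  set D : Set α := (W ∩ ⋂ q ∈ Q, q.2) \ (Prod.snd '' E) with hD
  have hDG : D ∈ G := Filter.inter_mem
    (Filter.inter_mem hW ((Filter.biInter_mem h.finite_right).2 fun q hq => (h.mem_right q hq).2))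
    (hG.le_cofinite (h.finite_points.image _).compl_mem_cofinite)
  set O' : Set α := insert b D with hO'
  have hdiff : ∀ T : Set α, (T \ W).Infinite → (T \ O').Infinite := fun T hT => by
    refine (hT.sdiff (Set.finite_singleton b)).mono ?_
    rintro x ⟨⟨hxT, hxW⟩, hxb⟩
    refine ⟨hxT, ?_⟩
    rintro (hx | hx)
    · exact hxb hx
    · exact hxW hx.1.1
  have hne : ∀ p ∈ P, p.2 ≠ O' := fun p hp heq => by
    obtain ⟨x, hx, hx'⟩ := (hdiff _ (hTW p.2 (Or.inr ⟨p, hp, rfl⟩))).nonempty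
    exact hx' (heq ▸ hx)
  have hO'G : O' ∈ G := Filter.mem_of_superset hDG (Set.subset_insert _ _)
  refine ⟨O', hO'G, Set.mem_insert _ _,
    { h with
      finite_left := h.finite_left.insert _
      mem_left := ?_
      fst_eq_of_snd_eq := ?_
      compatible := ?_
      forth := ?_
      back := ?_ }⟩
  · rintro p (rfl | hp)
    · exact ⟨hO, hO'G⟩
    · exact h.mem_left p hp
  · rintro p (rfl | hp) q (rfl | hq) hpq
    · rfl
    · exact (hne q hq hpq.symm).elim
    · exact (hne p hp hpq).elim
    · exact h.fst_eq_of_snd_eq p hp q hq hpq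
  · intro e he
    refine ⟨?_, (h.compatible e he).2⟩
    rintro p (rfl | hp)
    · rintro (heb | heD)
      · rwa [show e.1 = a from (h.fst_eq_iff e he (a, b) hab).2 heb]
      · exact (heD.2 ⟨e, he, rfl⟩).elim
    · exact (h.compatible e he).1 p hp
  · intro c hc
    refine (hdiff _ (hTW _ (Or.inl ⟨⟨c, rfl⟩, h.forth c hc⟩))).mono ?_
    rintro x ⟨hx, hxO'⟩
    refine ⟨?_, hx.2⟩
    rintro p (rfl | hp)
    · exact fun hx => (hxO' hx).elim
    · exact hx.1 p hp
  · intro c hc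
    by_cases hcO' : c ∈ O'
    · -- `c` lies in all answers on its side, so all points of a large set are compatible with it
      have hcD : c ∈ D := hcO'.resolve_left fun hcb => hc (a, b) hab hcb.symm
      refine (hF.infinite_of_mem (Filter.inter_mem hO ((Filter.biInter_mem h.finite_left).2
        fun p hp => (h.mem_left p hp).1))).mono ?_
      rintro x ⟨hxO, hxP⟩
      refine ⟨?_, fun q hq _ => Set.mem_iInter₂.1 hcD.1.2 q hq⟩
      rintro p (rfl | hp)
      · exact fun _ => hxO
      · exact fun _ => Set.mem_iInter₂.1 hxP p hp
    · refine (h.back c hc).mono fun x hx => ⟨?_, hx.2⟩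
      rintro p (rfl | hp)
      · exact fun hx => (hcO' hx).elim
      · exact hx.1 p hp

end IsPosition

open L2 in
/-- Along a position, `L_t`-formulas are transferred from left to right provided that they are
negative in the open variables whose values were given on the left, and positive in those whose
values were given on the right. -/
theorem L2.IsLt.sat_of_isPosition {R : Type v} [IsEmpty R] {α : Type u} {φ : L2 R} (hφ : φ.IsLt)
    {ν ν' : R → Set α} :
    ∀ {F G : Filter α}, IsThin F → IsThin G → ∀ {E : Set (α × α)} {P Q : Set (Set α × Set α)},
      IsPosition F G E P Q → ∀ {g g' : ℕ → α} {h h' : ℕ → Set α},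
      (∀ x ∈ φ.freePt, (g x, g' x) ∈ E) →
      (∀ U ∈ φ.freeOp, φ.NegativeIn U ∧ (h U, h' U) ∈ P ∨ φ.PositiveIn U ∧ (h U, h' U) ∈ Q) →
      Sat {O | @IsOpen α (filterTopology F) O} ν φ g h →
      Sat {O | @IsOpen α (filterTopology G) O} ν' φ g' h' := by
  induction hφ generalizing ν ν' with
  | top => exact fun _ _ _ _ _ _ _ _ _ _ _ _ _ => trivial
  | eqPt x y =>
    intro F G hF hG E P Q hpos g g' h h' hg hh hs
    exact (hpos.fst_eq_iff _ (hg x (Or.inl rfl)) _ (hg y (Or.inr rfl))).1 hs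
  | eqOp U V =>
    intro F G hF hG E P Q hpos g g' h h' hg hh hs
    have hU := (hh U (Or.inl rfl)).resolve_left fun hn => by simpa [NegativeIn, Polar] using hn.1
    have hV := (hh V (Or.inr rfl)).resolve_left fun hn => by simpa [NegativeIn, Polar] using hn.1
    exact hpos.snd_eq_of_fst_eq _ hU.2 _ hV.2 hs
  | pred p x => exact isEmptyElim p
  | mem x U =>
    intro F G hF hG E P Q hpos g g' h h' hg hh hs
    have hU := (hh U rfl).resolve_left fun hn => by simpa [NegativeIn, Polar] using hn.1
    exact (hpos.compatible _ (hg x rfl)).2 _ hU.2 hs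
  | neg _ ih =>
    intro F G hF hG E P Q hpos g g' h h' hg hh hs hs'
    exact hs (ih hG hF hpos.swap hg (fun U hU => (hh U hU).symm) hs')
  | and _ _ ih₁ ih₂ =>
    intro F G hF hG E P Q hpos g g' h h' hg hh hs
    exact ⟨ih₁ hF hG hpos (fun x hx => hg x (Or.inl hx))
        (fun U hU => (hh U (Or.inl hU)).imp (And.imp_left And.left) (And.imp_left And.left)) hs.1,
      ih₂ hF hG hpos (fun x hx => hg x (Or.inr hx))
        (fun U hU => (hh U (Or.inr hU)).imp (And.imp_left And.right) (And.imp_left And.right)) hs.2⟩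
  | exPt x _ ih =>
    intro F G hF hG E P Q hpos g g' h h' hg hh hs
    obtain ⟨a, ha⟩ := hs
    obtain ⟨b, E', hE, hab, hpos'⟩ := hpos.exists_point a
    refine ⟨b, ih hF hG hpos' (fun y hy => ?_) hh ha⟩
    by_cases hyx : y = x
    · subst hyx
      simpa using hab
    · simpa [hyx] using hE (hg y ⟨hy, hyx⟩)
  | @allOp x U φ _ hpol ih =>
    intro F G hF hG E P Q hpos g g' h h' hg hh hs
    rw [sat_allOp_imp] at hs ⊢
    intro O' hO' hx
    have hxE : (g x, g' x) ∈ E := hg x (Or.inl rfl)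
    obtain ⟨O, hOF, hxO, hpos'⟩ :=
      hpos.swap.exists_open hG hF (a := g' x) (b := g x) hxE (hO' ⟨_, hx⟩) hx
    refine ih hF hG hpos'.swap (fun y hy => hg y (Or.inr hy)) (fun V hV => ?_)
      (hs O (fun _ => hOF) hxO)
    by_cases hVU : V = U
    · subst hVU
      right
      simpa using hpol
    · simp only [Function.update_of_ne hVU]
      exact (hh V ⟨Or.inr hV, hVU⟩).imp (And.imp_left (polar_of_polar_allOp_imp hVU))
        (And.imp (polar_of_polar_allOp_imp hVU) Or.inr)
  | @exOp x U φ _ hpol ih =>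
    intro F G hF hG E P Q hpos g g' h h' hg hh hs
    rw [sat_exOp_and] at hs ⊢
    obtain ⟨O, hO, hx, hs⟩ := hs
    have hxE : (g x, g' x) ∈ E := hg x (Or.inl rfl)
    obtain ⟨O', hO'G, hxO', hpos'⟩ := hpos.exists_open hF hG hxE (hO ⟨_, hx⟩) hx
    refine ⟨O', fun _ => hO'G, hxO', ih hF hG hpos' (fun y hy => hg y (Or.inr hy))
      (fun V hV => ?_) hs⟩
    by_cases hVU : V = U
    · subst hVU
      left
      simpa using hpol
    · simp only [Function.update_of_ne hVU]
      exact (hh V ⟨Or.inr hV, hVU⟩).imp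
        (And.imp (polar_of_polar_exOp_and hVU) (Set.mem_insert_of_mem _))
        (And.imp_left (polar_of_polar_exOp_and hVU))

theorem IsPosition.empty {α : Type u} [Infinite α] (F G : Filter α) :
    IsPosition F G ∅ ∅ ∅ := by
  constructor <;> simp [Compatible, Set.infinite_univ]

theorem L2.IsLt.trueIn_filterTopology {α : Type u} [Infinite α] {φ : L2 Empty} (hφ : φ.IsLt)
    (hs : φ.IsSentence) {F G : Filter α} (hF : IsThin F) (hG : IsThin G)
    (hT : @L2.TrueIn φ α (filterTopology F)) : @L2.TrueIn φ α (filterTopology G) := by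
  intro g h _
  refine hφ.sat_of_isPosition hF hG (IsPosition.empty F G) (g := g) (h := fun _ => ∅) ?_ ?_
    (hT _ _ fun _ => @isOpen_empty _ (filterTopology F))
  · simp [hs.1]
  · simp [hs.2]

theorem not_ltDefinable_hereditarilyIrresolvable :
    ¬ LtDefinable HereditarilyIrresolvable.{u} := by
  rintro ⟨Γ, hΓ, hsent, hdef⟩
  obtain ⟨A, U, V, hU, hV, hUf, hVf⟩ := exists_ne_ultrafilter_le_cofinite (ULift.{u} ℕ)
  refine not_hereditarilyIrresolvable_filterTopology_sup hU hV
    ((@hdef _ (filterTopology _) _).2 fun φ hφ => ?_)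
  exact (hΓ φ hφ).trueIn_filterTopology (hsent φ hφ) (IsThin.of_ultrafilter hUf)
    ((IsThin.of_ultrafilter hUf).sup (IsThin.of_ultrafilter hVf))
    ((@hdef _ (filterTopology _) _).1 (hereditarilyIrresolvable_filterTopology U) φ hφ)

/-! ### Iterated ultrafilters -/

section IteratedUltrafilter

variable {I : Type u} {β γ : Type*}

/-- A function of sequences is finitary if it depends only on the first `n` terms for some `n`. -/
def IsFinitary (f : (ℕ → I) → β) : Prop := ∃ n, DependsOn f (Set.Iio n)

theorem IsFinitary.const (b : β) : IsFinitary fun _ : ℕ → I => b := ⟨0, fun _ _ _ => rfl⟩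

theorem IsFinitary.comp {f : (ℕ → I) → β} (hf : IsFinitary f) (φ : β → γ) :
    IsFinitary fun j => φ (f j) :=
  hf.imp fun _ hn _ _ h => congrArg φ (hn h)

theorem IsFinitary.prodMk {f : (ℕ → I) → β} {f' : (ℕ → I) → γ} (hf : IsFinitary f)
    (hf' : IsFinitary f') : IsFinitary fun j => (f j, f' j) := by
  obtain ⟨n, hn⟩ := hf
  obtain ⟨m, hm⟩ := hf'
  exact ⟨max n m, fun _ _ h => Prod.ext (hn fun k hk => h k (Set.mem_Iio.2 (lt_max_of_lt_left hk)))
    (hm fun k hk => h k (Set.mem_Iio.2 (lt_max_of_lt_right hk)))⟩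

theorem IsFinitary.comp₂ {δ : Type*} {f : (ℕ → I) → β} {f' : (ℕ → I) → γ} (hf : IsFinitary f)
    (hf' : IsFinitary f') (φ : β → γ → δ) : IsFinitary fun j => φ (f j) (f' j) :=
  (hf.prodMk hf').comp fun p => φ p.1 p.2

theorem update_eq_of_dependsOn {f : (ℕ → I) → β} {n m : ℕ} (hf : DependsOn f (Set.Iio n))
    (hnm : n ≤ m) (j : ℕ → I) (i : I) : f (Function.update j m i) = f j :=
  hf fun _ hk => Function.update_of_ne (lt_of_lt_of_le hk hnm).ne _ _

variable [Inhabited I]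

/-- The ultrafilter on sequences for which a property of the first `n` terms holds almost everywhere
iff it holds for `W`-almost all `j (n - 1)`, for `W`-almost all `j (n - 2)`, …, for `W`-almost all
`j 0`. The other terms are constant. -/
noncomputable def iteratedUltrafilter (W : Ultrafilter I) : ℕ → Ultrafilter (ℕ → I)
  | 0 => pure default
  | n + 1 => W.bind fun i => (iteratedUltrafilter W n).map fun j => Function.update j n i

/-- The common extension of the ultrafilters `iteratedUltrafilter W n`, as far as properties of
finitely many terms of a sequence are concerned. -/
noncomputable def limitUltrafilter (W : Ultrafilter I) : Ultrafilter (ℕ → I) :=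
  (Filter.hyperfilter ℕ).bind (iteratedUltrafilter W)

variable {W : Ultrafilter I}

theorem eventually_iteratedUltrafilter_succ {n : ℕ} {p : (ℕ → I) → Prop} :
    (∀ᶠ j in (iteratedUltrafilter W (n + 1) : Filter (ℕ → I)), p j) ↔
      ∀ᶠ i in (W : Filter I), ∀ᶠ j in (iteratedUltrafilter W n : Filter (ℕ → I)),
        p (Function.update j n i) := Iff.rfl

theorem eventually_iteratedUltrafilter_of_le {n m : ℕ} {p : (ℕ → I) → Prop}
    (hp : DependsOn p (Set.Iio n)) (hnm : n ≤ m) :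
    (∀ᶠ j in (iteratedUltrafilter W m : Filter (ℕ → I)), p j) ↔
      ∀ᶠ j in (iteratedUltrafilter W n : Filter (ℕ → I)), p j := by
  induction m, hnm using Nat.le_induction with
  | base => rfl
  | succ m hnm ih =>
    rw [eventually_iteratedUltrafilter_succ, ← ih]
    simp only [update_eq_of_dependsOn hp hnm, Filter.eventually_const]

theorem eventually_limitUltrafilter {n : ℕ} {p : (ℕ → I) → Prop} (hp : DependsOn p (Set.Iio n)) :
    (∀ᶠ j in (limitUltrafilter W : Filter (ℕ → I)), p j) ↔
      ∀ᶠ j in (iteratedUltrafilter W n : Filter (ℕ → I)), p j := by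
  have h : (∀ᶠ j in (limitUltrafilter W : Filter (ℕ → I)), p j) ↔
      ∀ᶠ m in (Filter.hyperfilter ℕ : Filter ℕ),
        ∀ᶠ j in (iteratedUltrafilter W m : Filter (ℕ → I)), p j := Iff.rfl
  rw [h, Filter.eventually_congr (Filter.Eventually.mono
    (Nat.hyperfilter_le_atTop (Filter.eventually_ge_atTop n))
    fun m hm => eventually_iteratedUltrafilter_of_le hp hm), Filter.eventually_const]

/-- A new term of the sequence is `W`-generic over the terms before it. -/
theorem eventually_limitUltrafilter_diag {n : ℕ} {p : I → (ℕ → I) → Prop}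
    (hp : ∀ i, DependsOn (p i) (Set.Iio n)) :
    (∀ᶠ j in (limitUltrafilter W : Filter (ℕ → I)), p (j n) j) ↔
      ∀ᶠ i in (W : Filter I), ∀ᶠ j in (limitUltrafilter W : Filter (ℕ → I)), p i j := by
  have hd : DependsOn (fun j : ℕ → I => p (j n) j) (Set.Iio (n + 1)) := fun j j' h => by
    dsimp only
    rw [h n (Nat.lt_succ_self n), hp _ fun k hk => h k (Nat.lt_succ_of_lt hk)]
  rw [eventually_limitUltrafilter hd, eventually_iteratedUltrafilter_succ]
  simp only [Function.update_self, update_eq_of_dependsOn (hp _) le_rfl,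
    eventually_limitUltrafilter (hp _)]

end IteratedUltrafilter

/-! ### The limit ultrapower of a space -/

/-- An ultrafilter on the finite sets `i` of subsets of `X` for which each subset `A` of `X` belongs to
almost all `i`. -/
noncomputable def indexUltrafilter (X : Type u) : Ultrafilter (Finset (Set X)) :=
  Ultrafilter.of Filter.atTop

theorem eventually_mem_indexUltrafilter {X : Type u} (A : Set X) :
    ∀ᶠ i in (indexUltrafilter X : Filter (Finset (Set X))), A ∈ i := by
  refine Ultrafilter.of_le _ ((Filter.eventually_ge_atTop {A}).mono fun i hi => ?_)
  exact hi (Finset.mem_singleton_self A)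

/-- Sequences of finite sets of subsets of `X`: the index set of the limit ultrapower. -/
abbrev Index (X : Type u) : Type u := ℕ → Finset (Set X)

/-- The ultrafilter on `Index X` defining the limit ultrapower. -/
noncomputable abbrev powerUltrafilter (X : Type u) : Ultrafilter (Index X) :=
  limitUltrafilter (indexUltrafilter X)

theorem eventually_mem_powerUltrafilter {X : Type u} (A : Set X) (n : ℕ) :
    ∀ᶠ j in (powerUltrafilter X : Filter (Index X)), A ∈ j n :=
  (eventually_limitUltrafilter_diag (p := fun i _ => A ∈ i) fun _ _ _ _ => rfl).2
    ((eventually_mem_indexUltrafilter A).mono fun _ hi => Filter.Eventually.of_forall fun _ => hi)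

/-- Almost everywhere equality of finitary functions. -/
def powerSetoid (X : Type u) : Setoid {s : Index X → X // IsFinitary s} where
  r s t := ∀ᶠ j in (powerUltrafilter X : Filter (Index X)), s.1 j = t.1 j
  iseqv :=
    { refl := fun _ => Filter.Eventually.of_forall fun _ => rfl
      symm := fun h => h.mono fun _ => Eq.symm
      trans := fun h h' => (h.and h').mono fun _ hj => hj.1.trans hj.2 }

/-- The limit ultrapower of `X`: it is the union of the chain of the iterated ultrapowers of `X`, the
functions that depend on the first `n` terms representing the points of the `n`-th one. -/
def LimitPower (X : Type u) : Type u := Quotient (powerSetoid X)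

namespace LimitPower

variable {X : Type u}

/-- The point of the limit ultrapower represented by a finitary function. -/
def mk (s : Index X → X) (hs : IsFinitary s) : LimitPower X := Quotient.mk (powerSetoid X) ⟨s, hs⟩

theorem exists_mk (a : LimitPower X) : ∃ s hs, mk s hs = a := by
  obtain ⟨⟨s, hs⟩, rfl⟩ := Quotient.exists_rep a
  exact ⟨s, hs, rfl⟩

theorem mk_eq_mk {s t : Index X → X} {hs : IsFinitary s} {ht : IsFinitary t} :
    mk s hs = mk t ht ↔ ∀ᶠ j in (powerUltrafilter X : Filter (Index X)), s j = t j :=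
  Quotient.eq

instance [Nonempty X] : Nonempty (LimitPower X) :=
  ⟨mk (fun _ => Classical.arbitrary X) (IsFinitary.const _)⟩

/-- The internal subset of the limit ultrapower given by a family of subsets of `X`. -/
def internal (U : Index X → Set X) : Set (LimitPower X) :=
  {a | Quotient.liftOn a
    (fun s => ∀ᶠ j in (powerUltrafilter X : Filter (Index X)), s.1 j ∈ U j)
    fun s t (h : ∀ᶠ j in (powerUltrafilter X : Filter (Index X)), s.1 j = t.1 j) =>
      propext (Filter.eventually_congr (h.mono fun j hj => by rw [hj]))}

theorem mk_mem_internal {s : Index X → X} {hs : IsFinitary s} {U : Index X → Set X} :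
    mk s hs ∈ internal U ↔ ∀ᶠ j in (powerUltrafilter X : Filter (Index X)), s j ∈ U j := Iff.rfl

/-- A saturation property: an ultrafilter all of whose members meet the internal set given by a finitary
family is realized by a point of that set. -/
theorem exists_mem_of_inter_nonempty [Nonempty X] {U : Index X → Set X} (hU : IsFinitary U)
    (w : Ultrafilter X)
    (h : ∀ A ∈ w, ∀ᶠ j in (powerUltrafilter X : Filter (Index X)), (U j ∩ A).Nonempty) :
    ∃ s : Index X → X, IsFinitary s ∧
      (∀ᶠ j in (powerUltrafilter X : Filter (Index X)), s j ∈ U j) ∧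
      ∀ A ∈ w, ∀ᶠ j in (powerUltrafilter X : Filter (Index X)), s j ∈ A := by
  obtain ⟨n, hn⟩ := hU
  let C : Finset (Set X) → Set X := fun i => ⋂₀ {A | A ∈ i ∧ A ∈ w}
  have hC : ∀ i, C i ∈ w := fun i =>
    (Filter.sInter_mem (i.finite_toSet.subset fun A hA => hA.1)).2 fun A hA => hA.2
  have hmem : ∀ᶠ j in (powerUltrafilter X : Filter (Index X)), (U j ∩ C (j n)).Nonempty :=
    (eventually_limitUltrafilter_diag (p := fun i j => (U j ∩ C i).Nonempty)
      fun i j j' hj => by dsimp only; rw [hn hj]).2 (Filter.Eventually.of_forall fun i => h _ (hC i))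
  have hs : ∀ᶠ j in (powerUltrafilter X : Filter (Index X)),
      Classical.epsilon (fun x => x ∈ U j ∩ C (j n)) ∈ U j ∩ C (j n) :=
    hmem.mono fun j hj => Classical.epsilon_spec hj
  refine ⟨fun j => Classical.epsilon fun x => x ∈ U j ∩ C (j n), ⟨n + 1, fun j j' hj => ?_⟩,
    hs.mono fun j hj => hj.1, fun A hAw => (hs.and
      (eventually_mem_powerUltrafilter A n)).mono fun j hj => hj.1.2 A ⟨hj.2, hAw⟩⟩
  dsimp only
  rw [hj n (Nat.lt_succ_self n), hn fun k hk => hj k (Nat.lt_succ_of_lt hk)]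

variable [TopologicalSpace X]

/-- The internal sets given by finitary families of open sets. -/
def internalOpens (X : Type u) [TopologicalSpace X] : Set (Set (LimitPower X)) :=
  {S | ∃ U : Index X → Set X, IsFinitary U ∧ (∀ j, IsOpen (U j)) ∧ S = internal U}

/-- The topology of the limit ultrapower is generated by the internal open sets. -/
instance : TopologicalSpace (LimitPower X) := TopologicalSpace.generateFrom (internalOpens X)

theorem isTopologicalBasis_internalOpens :
    TopologicalSpace.IsTopologicalBasis (internalOpens X) where
  exists_subset_inter := by
    rintro _ ⟨U, hU, hUo, rfl⟩ _ ⟨V, hV, hVo, rfl⟩ a ha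
    refine ⟨internal fun j => U j ∩ V j,
      ⟨_, hU.comp₂ hV (· ∩ ·), fun j => (hUo j).inter (hVo j), rfl⟩, ?_, fun b hb => ?_⟩
    · obtain ⟨s, hs, rfl⟩ := exists_mk a
      exact mk_mem_internal.2 ((mk_mem_internal.1 ha.1).and (mk_mem_internal.1 ha.2))
    · obtain ⟨s, hs, rfl⟩ := exists_mk b
      rw [mk_mem_internal] at hb
      exact ⟨hb.mono fun j hj => hj.1, hb.mono fun j hj => hj.2⟩
  sUnion_eq := by
    refine Set.eq_univ_of_forall fun a => ⟨_, ⟨fun _ => Set.univ, IsFinitary.const _,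
      fun _ => isOpen_univ, rfl⟩, ?_⟩
    obtain ⟨s, hs, rfl⟩ := exists_mk a
    exact mk_mem_internal.2 (Filter.Eventually.of_forall fun _ => trivial)
  eq_generateFrom := rfl

end LimitPower

/-! ### Truth of `L_t`-sentences in the limit ultrapower -/

namespace L2

variable {R : Type v} {X : Type u}

theorem sat_congr_free {σ : Set (Set X)} {ν : R → Set X} (φ : L2 R) {g g' : ℕ → X}
    {h h' : ℕ → Set X} (hg : ∀ x ∈ φ.freePt, g x = g' x) (hh : ∀ U ∈ φ.freeOp, h U = h' U) :
    Sat σ ν φ g h ↔ Sat σ ν φ g' h' := by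
  induction φ generalizing g g' h h' with
  | top => rfl
  | eqPt x y => simp only [Sat, hg x (Or.inl rfl), hg y (Or.inr rfl)]
  | eqOp U V => simp only [Sat, hh U (Or.inl rfl), hh V (Or.inr rfl)]
  | pred p x => simp only [Sat, hg x rfl]
  | mem x U => simp only [Sat, hg x rfl, hh U rfl]
  | neg φ ih => exact not_congr (ih hg hh)
  | and φ ψ ih₁ ih₂ =>
    exact and_congr (ih₁ (fun x hx => hg x (Or.inl hx)) fun U hU => hh U (Or.inl hU))
      (ih₂ (fun x hx => hg x (Or.inr hx)) fun U hU => hh U (Or.inr hU))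
  | exPt x φ ih =>
    refine exists_congr fun a => ih (fun y hy => ?_) hh
    by_cases hyx : y = x
    · subst hyx
      simp
    · simpa [hyx] using hg y ⟨hy, hyx⟩
  | exOp U φ ih =>
    refine exists_congr fun O => and_congr_right fun _ => ih hg fun V hV => ?_
    by_cases hVU : V = U
    · subst hVU
      simp
    · simpa [hVU] using hh V ⟨hV, hVU⟩

theorem sat_mono_of_polar {σ : Set (Set X)} {ν : R → Set X} {φ : L2 R} {U : ℕ} {b : Bool}
    (hφ : φ.NoOpenEq) (hp : φ.Polar U b) {A B : Set X} (hAB : A ⊆ B) {g : ℕ → X} {h : ℕ → Set X}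
    (hs : Sat σ ν φ g (Function.update h U (bif b then A else B))) :
    Sat σ ν φ g (Function.update h U (bif b then B else A)) := by
  induction φ generalizing b g h with
  | top => trivial
  | eqPt x y => exact hs
  | eqOp V W => exact hφ.elim
  | pred p x => exact hs
  | mem x V =>
    by_cases hVU : V = U
    · subst hVU
      obtain rfl := hp rfl
      simp only [Sat, Function.update_self, cond_true] at hs ⊢
      exact hAB hs
    · simpa [Sat, Function.update_of_ne hVU] using hs
  | neg φ ih =>
    intro hs'
    refine hs ?_
    have := @ih (!b) hφ hp g h
    cases b <;> exact this hs'
  | and φ ψ ih₁ ih₂ => exact ⟨ih₁ hφ.1 hp.1 hs.1, ih₂ hφ.2 hp.2 hs.2⟩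
  | exPt x φ ih => exact hs.imp fun a ha => ih hφ hp ha
  | exOp V φ ih =>
    obtain ⟨O, hO, hs⟩ := hs
    refine ⟨O, hO, ?_⟩
    by_cases hVU : V = U
    · subst hVU
      rw [Function.update_idem] at hs ⊢
      exact hs
    · rw [Function.update_comm (Ne.symm hVU)] at hs ⊢
      exact ih hφ (hp.resolve_left hVU) hs

/-- The quantifiers of `L_t` may be restricted to a base of the topology. -/
theorem IsLt.sat_basis_iff [TopologicalSpace X] {σ : Set (Set X)}
    (hσ : TopologicalSpace.IsTopologicalBasis σ) {ν : R → Set X} {φ : L2 R} (hφ : φ.IsLt)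
    (hne : φ.NoOpenEq) {g : ℕ → X} {h : ℕ → Set X} :
    Sat σ ν φ g h ↔ Sat {O | IsOpen O} ν φ g h := by
  induction hφ generalizing g h with
  | top => rfl
  | eqPt x y => rfl
  | eqOp U V => exact hne.elim
  | pred p x => rfl
  | mem x U => rfl
  | neg _ ih => exact not_congr (ih hne)
  | and _ _ ih₁ ih₂ => exact and_congr (ih₁ hne.1) (ih₂ hne.2)
  | exPt x _ ih => exact exists_congr fun a => ih hne
  | @allOp x U φ _ hpol ih =>
    have hφ : φ.NoOpenEq := hne.2
    rw [sat_allOp_imp, sat_allOp_imp]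
    refine ⟨fun hs O hO hx => ?_, fun hs O hO hx => (ih hφ).2 (hs O (hσ.isOpen hO) hx)⟩
    obtain ⟨B, hB, hxB, hBO⟩ := hσ.exists_subset_of_mem_open hx hO
    exact sat_mono_of_polar hφ hpol hBO ((ih hφ).1 (hs B hB hxB))
  | @exOp x U φ _ hpol ih =>
    have hφ : φ.NoOpenEq := hne.2
    rw [sat_exOp_and, sat_exOp_and]
    constructor
    · rintro ⟨O, hO, hx, hs⟩
      exact ⟨O, hσ.isOpen hO, hx, (ih hφ).1 hs⟩
    · rintro ⟨O, hO, hx, hs⟩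
      obtain ⟨B, hB, hxB, hBO⟩ := hσ.exists_subset_of_mem_open hx hO
      exact ⟨B, hB, hxB, (ih hφ).2 (sat_mono_of_polar hφ hpol hBO hs)⟩

end L2

namespace LimitPower

open L2

variable {X : Type u}

theorem update_mk {g : Index X → ℕ → X} (hg : IsFinitary g) {s : Index X → X} (hs : IsFinitary s)
    (x : ℕ) : Function.update (fun y => mk (fun j => g j y) (hg.comp fun k => k y)) x (mk s hs) =
      fun y => mk (fun j => Function.update (g j) x (s j) y)
        (hg.comp₂ hs fun k a => Function.update k x a y) := by
  funext y
  by_cases hyx : y = x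
  · subst hyx
    simp
  · simp [hyx]

theorem update_internal (h : Index X → ℕ → Set X) (S : Index X → Set X) (U : ℕ) :
    Function.update (fun V => internal fun j => h j V) U (internal S) =
      fun V => internal fun j => Function.update (h j) U (S j) V := by
  funext V
  by_cases hVU : V = U
  · subst hVU
    simp
  · simp [hVU]

variable [TopologicalSpace X]

/-- Łoś's theorem for the limit ultrapower. An assignment is given by a single finitary function, so
that the witnesses for the quantifiers, which are chosen as functions of it, are finitary as well. -/
theorem sat_internalOpens_iff [Nonempty X] {R : Type v} [IsEmpty R] {ν : R → Set X}
    {ν' : R → Set (LimitPower X)} {φ : L2 R} (hφ : φ.NoOpenEq) {g : Index X → ℕ → X}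
    (hg : IsFinitary g) {h : Index X → ℕ → Set X} (hh : IsFinitary h) :
    Sat (internalOpens X) ν' φ (fun x => mk (fun j => g j x) (hg.comp fun k => k x))
        (fun U => internal fun j => h j U) ↔
      ∀ᶠ j in (powerUltrafilter X : Filter (Index X)), Sat {O | IsOpen O} ν φ (g j) (h j) := by
  induction φ generalizing g h with
  | top => simp [Sat]
  | eqPt x y => exact mk_eq_mk
  | eqOp U V => exact hφ.elim
  | pred p x => exact isEmptyElim p
  | mem x U => exact mk_mem_internal
  | neg φ ih => exact (not_congr (ih hφ hg hh)).trans Ultrafilter.eventually_not.symm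
  | and φ ψ ih₁ ih₂ =>
    exact (and_congr (ih₁ hφ.1 hg hh) (ih₂ hφ.2 hg hh)).trans Filter.eventually_and.symm
  | exPt x φ ih =>
    simp only [Sat]
    constructor
    · rintro ⟨a, ha⟩
      obtain ⟨s, hs, rfl⟩ := exists_mk a
      rw [update_mk hg, ih hφ (hg.comp₂ hs fun k a => Function.update k x a) hh] at ha
      exact ha.mono fun j hj => ⟨s j, hj⟩
    · intro hs
      have hw : ∀ (k : ℕ → X) (l : ℕ → Set X), ∃ a,
          (∃ a, Sat {O | IsOpen O} ν φ (Function.update k x a) l) →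
            Sat {O | IsOpen O} ν φ (Function.update k x a) l := fun k l =>
        ⟨Classical.epsilon fun a => Sat {O | IsOpen O} ν φ (Function.update k x a) l,
          fun ha => Classical.epsilon_spec ha⟩
      choose w hw using hw
      have hfin := hg.comp₂ hh w
      refine ⟨mk _ hfin, ?_⟩
      rw [update_mk hg, ih hφ (hg.comp₂ hfin fun k a => Function.update k x a) hh]
      exact hs.mono fun j hj => hw _ _ hj
  | exOp U φ ih =>
    simp only [Sat]
    constructor
    · rintro ⟨_, ⟨S, hS, hSo, rfl⟩, ha⟩
      rw [update_internal, ih hφ hg (hh.comp₂ hS fun k a => Function.update k U a)] at ha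
      exact ha.mono fun j hj => ⟨S j, hSo j, hj⟩
    · intro hs
      have hw : ∀ (k : ℕ → X) (l : ℕ → Set X), ∃ O, IsOpen O ∧
          ((∃ O, IsOpen O ∧ Sat {O | IsOpen O} ν φ k (Function.update l U O)) →
            Sat {O | IsOpen O} ν φ k (Function.update l U O)) := fun k l => by
        by_cases hO : ∃ O, IsOpen O ∧ Sat {O | IsOpen O} ν φ k (Function.update l U O)
        · obtain ⟨O, hO, hsat⟩ := hO
          exact ⟨O, hO, fun _ => hsat⟩
        · exact ⟨∅, isOpen_empty, fun hO' => (hO hO').elim⟩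
      choose w hwo hw using hw
      have hfin := hg.comp₂ hh w
      refine ⟨internal fun j => w (g j) (h j), ⟨_, hfin, fun j => hwo _ _, rfl⟩, ?_⟩
      rw [update_internal, ih hφ hg (hh.comp₂ hfin fun k a => Function.update k U a)]
      exact hs.mono fun j hj => hw _ _ hj

theorem trueIn_of_trueIn [Nonempty X] {φ : L2 Empty} (hφ : φ.IsLt) (hne : φ.NoOpenEq)
    (hs : φ.IsSentence) (h : φ.TrueIn X) : φ.TrueIn (LimitPower X) := by
  intro g k _
  rw [← hφ.sat_basis_iff isTopologicalBasis_internalOpens hne]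
  have key := (sat_internalOpens_iff (ν := fun p : Empty => p.elim) (ν' := fun p : Empty => p.elim)
    hne (IsFinitary.const fun _ => Classical.arbitrary X)
    (IsFinitary.const fun _ => (∅ : Set X))).2
    (Filter.Eventually.of_forall fun j => h _ _ fun _ => isOpen_empty)
  exact (sat_congr_free φ (by simp [hs.1]) (by simp [hs.2])).1 key

end LimitPower

/-! ### The limit ultrapower and the Alexandroff extension -/

namespace LimitPower

variable {X : Type u}

/-- The map from the limit ultrapower to the Alexandroff extension: a subset `A` of `X` belongs to the
image of a point iff the point belongs to the internal set given by the constant family `A`. -/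
noncomputable def toAlexandroffExtension (X : Type u) : LimitPower X → AlexandroffExtension X :=
  Quotient.lift (fun s => (powerUltrafilter X).map s.1)
    fun _ _ h => Ultrafilter.coe_injective (Filter.map_congr h)

theorem mem_toAlexandroffExtension_mk {s : Index X → X} {hs : IsFinitary s} {A : Set X} :
    A ∈ Ultrafilter.toFilter (α := X) (toAlexandroffExtension X (mk s hs)) ↔
      ∀ᶠ j in (powerUltrafilter X : Filter (Index X)), s j ∈ A := Iff.rfl

/-- The filter of all subsets `A` of `X` such that the internal set given by `U` is contained in the one
given by the constant family `A`. -/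
def extensionFilter (U : Index X → Set X) : Filter X where
  sets := {A | ∀ᶠ j in (powerUltrafilter X : Filter (Index X)), U j ⊆ A}
  univ_sets := (Filter.Eventually.of_forall fun j => Set.subset_univ (U j) :
    ∀ᶠ j in (powerUltrafilter X : Filter (Index X)), U j ⊆ Set.univ)
  sets_of_superset {A _} (h : ∀ᶠ j in (powerUltrafilter X : Filter (Index X)), U j ⊆ A) hAB :=
    h.mono fun _ hj => hj.trans hAB
  inter_sets {A B} (hA : ∀ᶠ j in (powerUltrafilter X : Filter (Index X)), U j ⊆ A)
    (hB : ∀ᶠ j in (powerUltrafilter X : Filter (Index X)), U j ⊆ B) :=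
    (hA.and hB).mono fun _ hj => Set.subset_inter hj.1 hj.2

theorem mem_extensionFilter {U : Index X → Set X} {A : Set X} :
    A ∈ extensionFilter U ↔ ∀ᶠ j in (powerUltrafilter X : Filter (Index X)), U j ⊆ A := Iff.rfl

theorem image_internal [Nonempty X] {U : Index X → Set X} (hU : IsFinitary U) :
    toAlexandroffExtension X '' internal U =
      {w : Ultrafilter X | ∀ A ∈ extensionFilter U, A ∈ w} := by
  ext w
  constructor
  · rintro ⟨a, ha, rfl⟩ A hA
    obtain ⟨s, hs, rfl⟩ := exists_mk a
    exact mem_toAlexandroffExtension_mk.2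
      (((mk_mem_internal.1 ha).and (mem_extensionFilter.1 hA)).mono fun j hj => hj.2 hj.1)
  · intro hw
    obtain ⟨s, hs, hsU, hsw⟩ := exists_mem_of_inter_nonempty hU (w : Ultrafilter X) fun A hA => by
      by_contra hne
      rw [← Ultrafilter.eventually_not] at hne
      refine Ultrafilter.compl_notMem_iff.2 hA (hw _
        (mem_extensionFilter.2 (hne.mono fun j hj x hx hxA => hj ⟨x, hx, hxA⟩)))
    refine ⟨mk s hs, hsU, ?_⟩
    exact Ultrafilter.eq_of_le (α := X) fun A hA => hsw A hA

theorem surjective_toAlexandroffExtension [Nonempty X] :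
    Function.Surjective (toAlexandroffExtension X) := by
  intro w
  have h : w ∈ toAlexandroffExtension X '' internal fun _ => Set.univ := by
    rw [image_internal (IsFinitary.const _)]
    intro A hA
    obtain ⟨j, hj⟩ := (mem_extensionFilter.1 hA).exists
    rw [Set.univ_subset_iff.1 hj]
    exact Filter.univ_mem
  obtain ⟨a, -, ha⟩ := h
  exact ⟨a, ha⟩

variable [TopologicalSpace X]

theorem continuous_toAlexandroffExtension : Continuous (toAlexandroffExtension X) := by
  rw [continuous_generateFrom_iff]
  rintro _ ⟨F, hF, rfl⟩
  rw [isTopologicalBasis_internalOpens.isOpen_iff]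
  intro a ha
  obtain ⟨s, hs, rfl⟩ := exists_mk a
  -- `s` has the internal open neighbourhood formed by intersecting the interiors of those members of
  -- `F` in the finite set `j 0` that are neighbourhoods of `s j`; every member of `F` takes part in this
  let C : X → Finset (Set X) → Set X := fun x i =>
    ⋂₀ (interior '' {A | A ∈ i ∧ A ∈ F ∧ x ∈ interior A})
  have hC : ∀ x i, IsOpen (C x i) := fun x i => by
    refine Set.Finite.isOpen_sInter ((i.finite_toSet.subset fun A hA => hA.1).image _) ?_
    rintro _ ⟨A, -, rfl⟩
    exact isOpen_interior
  have h0 : IsFinitary fun j : Index X => j 0 := ⟨1, fun j j' h => h 0 Nat.zero_lt_one⟩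
  refine ⟨_, ⟨fun j => C (s j) (j 0), hs.comp₂ h0 C, fun j => hC _ _, rfl⟩, ?_, fun b hb A hA => ?_⟩
  · refine mk_mem_internal.2 (Filter.Eventually.of_forall fun j => ?_)
    rintro _ ⟨A, hA, rfl⟩
    exact hA.2.2
  · obtain ⟨t, ht, rfl⟩ := exists_mk b
    have hA0 := eventually_mem_powerUltrafilter A 0
    have hsA : ∀ᶠ j in (powerUltrafilter X : Filter (Index X)), s j ∈ interior A := ha _ (hF A hA)
    refine mem_toAlexandroffExtension_mk.2
      (((mk_mem_internal.1 hb).and (hA0.and hsA)).mono fun j hj => ?_)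
    exact interior_subset (hj.1 _ ⟨A, ⟨hj.2.1, hA, hj.2.2⟩, rfl⟩)

theorem isOpenFilter_extensionFilter {U : Index X → Set X} (hU : ∀ j, IsOpen (U j)) :
    IsOpenFilter (extensionFilter U) := fun _ hA =>
  mem_extensionFilter.2 ((mem_extensionFilter.1 hA).mono fun j hj => interior_maximal hj (hU j))

theorem isOpenMap_toAlexandroffExtension [Nonempty X] : IsOpenMap (toAlexandroffExtension X) := by
  rw [isTopologicalBasis_internalOpens.isOpenMap_iff]
  rintro _ ⟨U, hU, hUo, rfl⟩
  rw [image_internal hU]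
  exact TopologicalSpace.isOpen_generateFrom_of_mem
    ⟨extensionFilter U, isOpenFilter_extensionFilter hUo, rfl⟩

end LimitPower

/-! ### Interior maps preserve modal validity -/

namespace ML

variable {P : Type v} {X Y : Type u} [TopologicalSpace X] [TopologicalSpace Y] {f : X → Y}

theorem holds_preimage_iff (hc : Continuous f) (ho : IsOpenMap f) (ν : P → Set Y) (φ : ML P)
    (w : X) : Holds (fun p => f ⁻¹' ν p) φ w ↔ Holds ν φ (f w) := by
  induction φ generalizing w with
  | top => rfl
  | letter p => rfl
  | and φ ψ ih₁ ih₂ => exact and_congr (ih₁ w) (ih₂ w)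
  | neg φ ih => exact not_congr (ih w)
  | box φ ih =>
    rw [holds_box, holds_box]
    simp only [ih]
    rw [← Set.mem_preimage (f := f), ho.preimage_interior_eq_interior_preimage hc]
    rfl

theorem Valid.of_surjective {φ : ML P} (hφ : φ.Valid X) (hc : Continuous f) (ho : IsOpenMap f)
    (hf : Function.Surjective f) : φ.Valid Y := by
  intro ν w
  obtain ⟨a, rfl⟩ := hf w
  exact (holds_preimage_iff hc ho ν φ a).1 (hφ _ a)

end ML

theorem alexandroffExtension_mem_of_definable {K : SpaceClass.{u}} (hM : ModallyDefinable K)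
    (hL : LtDefinableNoOpenEq K) (X : Type u) [TopologicalSpace X] [Nonempty X] (hX : K X) :
    K (AlexandroffExtension X) := by
  obtain ⟨Γ, hΓ⟩ := hM
  obtain ⟨Δ, hΔ, hsent, hdef⟩ := hL
  have hX' : K (LimitPower X) := (hdef _).2 fun φ hφ =>
    LimitPower.trueIn_of_trueIn (hΔ φ hφ).1 (hΔ φ hφ).2 (hsent φ hφ) ((hdef X).1 hX φ hφ)
  have : Nonempty (AlexandroffExtension X) :=
    (inferInstance : Nonempty (LimitPower X)).map (LimitPower.toAlexandroffExtension X)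
  exact (hΓ _).2 fun φ hφ => ((hΓ _).1 hX' φ hφ).of_surjective
    LimitPower.continuous_toAlexandroffExtension LimitPower.isOpenMap_toAlexandroffExtension
    LimitPower.surjective_toAlexandroffExtension

end TopoModal

theorem mainTheorem10 :
    -- Grz defines the class of hereditarily irresolvable spaces
    ModallyDefines {ML.grz 0} HereditarilyIrresolvable.{u} ∧
    -- this class is not definable in `L_t`
    ¬ LtDefinable HereditarilyIrresolvable.{u} ∧
    -- modally and `L_t`-definable classes are closed under Alexandroff extensions
    (∀ K : SpaceClass.{u}, ModallyDefinable K → LtDefinableNoOpenEq K →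
      ∀ (X : Type u) [TopologicalSpace X] [Nonempty X], K X → K (AlexandroffExtension X)) ∧
    -- `ℕ` with the topology of downward closed sets is hereditarily irresolvable
    HereditarilyIrresolvable (Topology.WithLowerSet ℕ) ∧
    -- its Alexandroff extension is not
    ¬ HereditarilyIrresolvable (AlexandroffExtension (Topology.WithLowerSet ℕ)) := by
  refine ⟨fun X _ _ => ?_, not_ltDefinable_hereditarilyIrresolvable,
    fun K hM hL X _ _ hX => alexandroffExtension_mem_of_definable hM hL X hX,
    hereditarilyIrresolvable_withLowerSet_nat, not_hereditarilyIrresolvable_alexandroffExtension⟩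
  rw [← valid_grz_iff_hereditarilyIrresolvable (0 : ℕ)]
  simp
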